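/- Work over $\mathbb C$; $\mathbb N=\{1,2,\dots\}$, $\frac12\mathbb N=\{\frac12,1,\frac32,\dots\}$. Let $\mathbb C^{\infty|\infty}$ be the superspace with basis $e_p$, $p\in\frac12\mathbb Z$, where $e_p$ is even for $p\in\mathbb Z$ and odd for $p\in\frac12+\mathbb Z$. Let $\mathfrak{gl}_{\infty|\infty}$ be the Lie superalgebra of complex matrices $(a_{ij})_{i,j\in\frac12\mathbb Z}$ with only finitely many non-zero diagonals, with the super-bracket $[A,B]=AB-(-1)^{|A||B|}BA$, graded by $\frac12\mathbb Z$ so that the matrix unit $e_{ij}$ has degree $j-i$; elements of integral degree are even and those of degree in $\frac12+\mathbb Z$ are odd. Define a bilinear form by $(e_i|e_j)=\delta_{i,-j}$ for $i,j\in\mathbb Z\setminus\{0\}$, $(e_r|e_s)=\mathrm{sgn}(r)\,\delta_{r,-s}$ for $r,s\in\frac12+\mathbb Z$, and $(e_i|e_r)=(e_r|e_i)=0$. Let $\mathcal D=\mathcal D_{\bar0}\oplus\mathcal D_{\bar1}$, where $\mathcal D_{\epsilon}$ consists of the $A\in\mathfrak{gl}_{\infty|\infty}$ of parity $\epsilon$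 whose row $0$ and column $0$ vanish and which satisfy $(Av|w)=-(-1)^{\epsilon|v|}(v|Aw)$ for all $v,w$ in the span of the $e_p$, $p\neq0$, with $v$ homogeneous. Let $\hat D=\mathcal D\oplus\mathbb C C$ be the central extension, by an even central element $C$ of degree $0$, given by the cocycle $\alpha(A,B)=\mathrm{Str}([J,A]B)$, where $J=\sum_{r\le0}e_{rr}$ and $\mathrm{Str}(a_{ij})=\sum_r(-1)^{2r}a_{rr}$. Thus $\hat D=\bigoplus_{k\in\frac12\mathbb Z}\hat D_k$. Put $\tilde e_{rr}=e_{rr}-e_{-r,-r}$; then $\hat D_0$ is abelian and consists of the elements $\sum_{r\in\frac12\mathbb N}a_r\tilde e_{rr}+dC$ with $a_r,d\in\mathbb C$ (infinitely many $a_r$ may be non-zero). Define $\omega_s,\Lambda_0\in(\hat D_0)^*$ for $s\in\frac12\mathbb N$ by $$\omega_s\Big(\sum_r a_r\tilde e_{rr}+dC\Big)=a_s,\qquad \Lambda_0\Big(\sum_r a_r\tilde e_{rr}+dC\Big)=d .$$ A highest weight $\hat D$-module with highest weight $\xi\in(\hat D_0)^*$ is a ($\mathbb Z/2$-graded) $\hat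 D$-module $M$ with a non-zero vector $v_\xi$, called a highest weight vector, such that $hv_\xi=\xi(h)v_\xi$ for all $h\in\hat D_0$, $\hat D_kv_\xi=0$ for all $k>0$, and $\mathcal U(\hat D_-)v_\xi=M$, where $\hat D_-=\bigoplus_{k<0}\hat D_k$. Such an $M$ is $\frac12\mathbb Z$-graded by giving $v_\xi$ degree $0$: $M_k$ is the span of the vectors $x_1\cdots x_nv_\xi$ ($n\ge0$) with $x_i\in\hat D_{k_i}$ and $k_1+\dots+k_n=k$. It is called quasi-finite if $\dim M_k<\infty$ for all $k\in\frac12\mathbb Z$. It is irreducible if it has no ($\mathbb Z/2$-graded) submodules other than $0\ne M$ and $M$. **Theorem.** Let $M$ be an irreducible highest weight $\hat D$-module with highest weight $\xi$, and let $v_\xi$ be a non-zero highest weight vector of $M$. Then the following are equivalent: 1. $M$ is quasi-finite; 2. the vector space $\hat D_{-1/2}\,v_\xi=\{xv_\xi: x\in\hat D_{-1/2}\}$ is finite dimensional; 3. there exist $N\in\mathbb N$ and $\xi_j,d\in\mathbb C$ such that $\xi=\sum_{j\in\frac12\mathbb N,\ j\le N}\xi_j\,\omega_j+d\Lambda_0$.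 -/

import Mathlib

/-! Infinite matrices with rows and columns indexed by the half integers.
Throughout, the half integer `p` is encoded by the integer `n = 2 p`. So the basis vector `e_p` is
even if `n` is even and odd if `n` is odd, all degrees are doubled, and degree `p` is written as
the integer `2 p`. -/

namespace InfRank

/-- Complex matrices with rows and columns indexed by the half integers. -/
abbrev Mat : Type := ℤ → ℤ → ℂ

/-- The matrix `A` has only finitely many nonzero diagonals. -/
def Banded (A : Mat) : Prop := ∃ K : ℤ, ∀ i j : ℤ, K < |j - i| → A i j = 0

/-- The product of two matrices (used for banded matrices, where the sums are finite). -/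
noncomputable def mul (A B : Mat) : Mat := fun i j => ∑ᶠ k, A i k * B k j

/-- The super bracket `[A, B] = A B - (-1)^{|A| |B|} B A`, extended bilinearly from homogeneous
matrices: the `(i, j)` entry of a matrix belongs to its component of (doubled) degree `j - i`. -/
noncomputable def superBracket (A B : Mat) : Mat := fun i j =>
  mul A B i j - ∑ᶠ k, (-1 : ℂ) ^ ((k - i) * (j - k)) * (B i k * A k j)

/-- The supertrace (used when only finitely many diagonal entries are nonzero). -/
noncomputable def str (A : Mat) : ℂ := ∑ᶠ i : ℤ, (-1 : ℂ) ^ i * A i i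

/-- The matrix `J = ∑_{r ≤ 0} e_{rr}`. -/
def J : Mat := fun i j => if i = j ∧ i ≤ 0 then 1 else 0

/-- The two-cocycle `α(A, B) = Str([J, A] B)`. -/
noncomputable def cocycle (A B : Mat) : ℂ := str (mul (superBracket J A) B)

/-- The supersymmetric bilinear form on basis vectors: `(e_i | e_j) = δ_{i,-j}` for `i`, `j`
nonzero integers, `(e_r | e_s) = sgn(r) δ_{r,-s}` for `r`, `s` in `1/2 + ℤ`, and zero otherwise. -/
noncomputable def form (i j : ℤ) : ℂ :=
  if i + j = 0 ∧ i ≠ 0 then (if Even i then 1 else (Int.sign i : ℂ)) else 0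

/-- `(A v | w) = -(-1)^{ε |v|} (v | A w)` for the homogeneous components `A_ε` of `A`, on basis
vectors `v = e_j`, `w = e_k`. Only the component of parity `ε = j + k` of `A` contributes. -/
def PreservesForm (A : Mat) : Prop := ∀ j k : ℤ,
  ∑ᶠ i, A i j * form i k = -((-1 : ℂ) ^ ((j + k) * j) * ∑ᶠ i, form j i * A i k)

lemma form_finsum_left (A : Mat) (j k : ℤ) :
    ∑ᶠ i, A i j * form i k = A (-k) j * form (-k) k := by
  refine finsum_eq_single _ _ fun i hi => ?_
  have h : ¬ (i + k = 0 ∧ i ≠ 0) := fun h => hi (by omega)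
  rw [form, if_neg h, mul_zero]

lemma form_finsum_right (A : Mat) (j k : ℤ) :
    ∑ᶠ i, form j i * A i k = form j (-j) * A (-j) k := by
  refine finsum_eq_single _ _ fun i hi => ?_
  have h : ¬ (j + i = 0 ∧ j ≠ 0) := fun h => hi (by omega)
  rw [form, if_neg h, zero_mul]

lemma preservesForm_iff (A : Mat) : PreservesForm A ↔ ∀ j k : ℤ,
    A (-k) j * form (-k) k = -((-1 : ℂ) ^ ((j + k) * j) * (form j (-j) * A (-j) k)) := by
  simp only [PreservesForm, form_finsum_left, form_finsum_right]

/-- The Lie superalgebra `𝒟` of banded matrices with vanishing row and column `0` that preserve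
the form. -/
noncomputable def D : Submodule ℂ Mat where
  carrier := {A | Banded A ∧ (∀ i j : ℤ, i = 0 ∨ j = 0 → A i j = 0) ∧ PreservesForm A}
  zero_mem' := by
    refine ⟨⟨0, fun _ _ _ => rfl⟩, fun _ _ _ => rfl, ?_⟩
    rw [preservesForm_iff]
    simp
  add_mem' := by
    rintro A B ⟨⟨K, hK⟩, hA0, hA⟩ ⟨⟨L, hL⟩, hB0, hB⟩
    refine ⟨⟨max K L, fun i j h => ?_⟩, fun i j h => ?_, ?_⟩
    · simp [hK i j (lt_of_le_of_lt (le_max_left _ _) h),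
        hL i j (lt_of_le_of_lt (le_max_right _ _) h)]
    · simp [hA0 i j h, hB0 i j h]
    · rw [preservesForm_iff] at *
      intro j k
      have h1 := hA j k
      have h2 := hB j k
      simp only [Pi.add_apply]
      linear_combination h1 + h2
  smul_mem' := by
    rintro c A ⟨⟨K, hK⟩, hA0, hA⟩
    refine ⟨⟨K, fun i j h => ?_⟩, fun i j h => ?_, ?_⟩
    · simp [hK i j h]
    · simp [hA0 i j h]
    · rw [preservesForm_iff] at *
      intro j k
      have h1 := hA j k
      simp only [Pi.smul_apply, smul_eq_mul]
      linear_combination c * h1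

lemma neg_one_zpow_eq (n : ℤ) : (-1 : ℂ) ^ n = if Even n then 1 else -1 := by
  split_ifs with h
  · exact h.neg_one_zpow
  · exact (Int.not_even_iff_odd.mp h).neg_one_zpow

lemma form_sq {j : ℤ} (hj : j ≠ 0) : form j (-j) * form j (-j) = 1 := by
  rcases lt_or_gt_of_ne hj with h' | h' <;> by_cases he : Even j <;>
    simp [form, hj, he, Int.sign_eq_one_of_pos, Int.sign_eq_neg_one_of_neg, h']

/-- The entries of a matrix in `𝒟` at opposite positions determine each other. -/
lemma D_flip {A : Mat} (hA : A ∈ D) (i : ℤ) {j : ℤ} (hj : j ≠ 0) :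
    A (-j) (-i) = -((-1 : ℂ) ^ ((j - i) * j) * (form i (-i) * form j (-j)) * A i j) := by
  have h := (preservesForm_iff A).mp hA.2.2 j (-i)
  have hsq : form j (-j) * form j (-j) = 1 := form_sq hj
  have hs : (-1 : ℂ) ^ ((j - i) * j) * (-1 : ℂ) ^ ((j - i) * j) = 1 := by
    rw [neg_one_zpow_eq]; split_ifs <;> norm_num
  rw [neg_neg, ← sub_eq_add_neg] at h
  linear_combination ((-1 : ℂ) ^ ((j - i) * j) * form j (-j)) * h
    - (A (-j) (-i)) * hs * form j (-j) * form j (-j) - A (-j) (-i) * hsq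

lemma preservesForm_of_flip {A : Mat} (h0 : ∀ i j : ℤ, i = 0 ∨ j = 0 → A i j = 0)
    (h : ∀ i j : ℤ, i ≠ 0 → j ≠ 0 →
      A (-j) (-i) = -((-1 : ℂ) ^ ((j - i) * j) * (form i (-i) * form j (-j)) * A i j)) :
    PreservesForm A := by
  rw [preservesForm_iff]
  intro j k
  by_cases hj : j = 0
  · subst hj; simp [h0, form]
  by_cases hk : k = 0
  · subst hk; simp [h0, form]
  have hh := h (-k) j (by omega) hj
  have hsq : form j (-j) * form j (-j) = 1 := form_sq hj
  have hs : (-1 : ℂ) ^ ((j + k) * j) * (-1 : ℂ) ^ ((j + k) * j) = 1 := by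
    rw [neg_one_zpow_eq]; split_ifs <;> norm_num
  rw [neg_neg, sub_neg_eq_add] at hh
  rw [hh]
  linear_combination -(A (-k) j * form (-k) k * form j (-j) * form j (-j)) * hs
    - A (-k) j * form (-k) k * hsq

lemma finite_support_aux {A : Mat} (hA : Banded A) (i : ℤ) (f : ℤ → ℂ)
    (h : ∀ k, A i k = 0 → f k = 0) : (Function.support f).Finite := by
  obtain ⟨K, hK⟩ := hA
  refine (Set.finite_Icc (i - |K|) (i + |K|)).subset fun k hk => ?_
  by_contra hn
  refine hk (h k (hK i k ?_))
  rw [Set.mem_Icc, not_and_or] at hn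
  have := le_abs_self K
  rcases hn with hn | hn
  · have := neg_le_abs (k - i); omega
  · have := le_abs_self (k - i); omega

lemma superBracket_eq {A B : Mat} (hA : Banded A) (hB : Banded B) (i j : ℤ) :
    superBracket A B i j =
      ∑ᶠ k, (A i k * B k j - (-1 : ℂ) ^ ((k - i) * (j - k)) * (B i k * A k j)) := by
  rw [superBracket, mul, finsum_sub_distrib]
  · exact finite_support_aux hA i _ fun k hk => by simp [hk]
  · exact finite_support_aux hB i _ fun k hk => by simp [hk]

lemma superBracket_mem_D {A B : Mat} (hA : A ∈ D) (hB : B ∈ D) : superBracket A B ∈ D := by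
  have h0 : ∀ i j : ℤ, i = 0 ∨ j = 0 → superBracket A B i j = 0 := by
    intro i j h
    rw [superBracket_eq hA.1 hB.1]
    refine finsum_eq_zero_of_forall_eq_zero fun k => ?_
    rcases h with h | h
    · simp [hA.2.1 i k (Or.inl h), hB.2.1 i k (Or.inl h)]
    · simp [hA.2.1 k j (Or.inr h), hB.2.1 k j (Or.inr h)]
  refine ⟨?_, h0, preservesForm_of_flip h0 fun i j hi hj => ?_⟩
  · obtain ⟨K, hK⟩ := hA.1
    obtain ⟨L, hL⟩ := hB.1
    refine ⟨K + L, fun i j h => ?_⟩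
    rw [superBracket_eq hA.1 hB.1]
    refine finsum_eq_zero_of_forall_eq_zero fun k => ?_
    have htri : |j - i| ≤ |k - i| + |j - k| := by
      have := abs_add_le (k - i) (j - k)
      rwa [show k - i + (j - k) = j - i by ring] at this
    have h1 : A i k * B k j = 0 := by
      by_cases h' : K < |k - i|
      · simp [hK i k h']
      · simp [hL k j (by omega)]
    have h2 : B i k * A k j = 0 := by
      by_cases h' : L < |k - i|
      · simp [hL i k h']
      · simp [hK k j (by omega)]
    simp [h1, h2]
  · have hfin : (Function.support fun k =>
        (A i k * B k j - (-1 : ℂ) ^ ((k - i) * (j - k)) * (B i k * A k j))).Finite := by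
      refine ((finite_support_aux hA.1 i (fun k => A i k) fun _ h => h).union
        (finite_support_aux hB.1 i (fun k => B i k) fun _ h => h)).subset fun k hk => ?_
      by_contra hn
      simp only [Set.mem_union, Function.mem_support, not_or, not_not] at hn
      exact hk (by simp [hn.1, hn.2])
    rw [superBracket_eq hA.1 hB.1, superBracket_eq hA.1 hB.1, mul_finsum,
      ← finsum_neg_distrib, ← finsum_comp_equiv (Equiv.neg ℤ)]
    refine finsum_congr fun k => ?_
    simp only [Equiv.neg_apply]
    by_cases hk : k = 0
    · subst hk
      have a1 := hA.2.1 i 0 (Or.inr rfl)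
      have a2 := hA.2.1 0 j (Or.inl rfl)
      have a3 := hA.2.1 (-j) 0 (Or.inr rfl)
      have a4 := hA.2.1 0 (-i) (Or.inl rfl)
      simp [a1, a2, a3, a4]
    · rw [D_flip hA k hj, D_flip hB i hk, D_flip hB k hj, D_flip hA i hk]
      have hsq : form k (-k) * form k (-k) = 1 := form_sq hk
      have e1 : (-1 : ℂ) ^ ((j - k) * j) * (-1 : ℂ) ^ ((k - i) * k) =
          (-1 : ℂ) ^ ((j - i) * j) * (-1 : ℂ) ^ ((k - i) * (j - k)) := by
        rw [← zpow_add₀ (by norm_num), ← zpow_add₀ (by norm_num)]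
        simp only [neg_one_zpow_eq]
        congr 1
        simp only [Int.even_add, Int.even_sub, Int.even_mul, eq_iff_iff]
        tauto
      have e2 : (-1 : ℂ) ^ ((-k - -j) * (-i - -k)) = (-1 : ℂ) ^ ((k - i) * (j - k)) := by
        congr 1; ring
      have e3 : (-1 : ℂ) ^ ((k - i) * (j - k)) * (-1 : ℂ) ^ ((k - i) * (j - k)) = 1 := by
        rw [neg_one_zpow_eq]; split_ifs <;> norm_num
      rw [e2]
      generalize (-1 : ℂ) ^ ((j - k) * j) = s1 at *
      generalize (-1 : ℂ) ^ ((k - i) * k) = s2 at *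
      generalize (-1 : ℂ) ^ ((j - i) * j) = s3 at *
      generalize (-1 : ℂ) ^ ((k - i) * (j - k)) = s4 at *
      generalize form k (-k) = fk at *
      generalize form i (-i) = fi at *
      generalize form j (-j) = fj at *
      have e4 : s4 * (s1 * s2) = s3 := by rw [e1]; linear_combination s3 * e3
      linear_combination (fi * fj * A k j * B i k * s1 * s2 - s4 * s1 * s2 * fi * fj * A i k * B k j)
          * hsq + fi * fj * A k j * B i k * e1 - fi * fj * A i k * B k j * e4

/-- The underlying space `𝒟 ⊕ ℂ C` of the central extension `D̂`. -/
abbrev HatD : Type := D × ℂ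

/-- The bracket of `D̂`: `[A + c C, B + d C] = [A, B] + α(A, B) C`. -/
noncomputable def HatD.bracket (x y : HatD) : HatD :=
  (⟨superBracket x.1 y.1, superBracket_mem_D x.1.2 y.1.2⟩, cocycle x.1 y.1)

/-- The homogeneous component of `D̂` of (doubled) degree `k`: the matrices
`∑_j a_j e_{j-k,j}`, together with `ℂ C` if `k = 0`. It is even or odd according to `k`. -/
noncomputable def HatD.deg (k : ℤ) : Submodule ℂ HatD where
  carrier := {x | (∀ i j : ℤ, j - i ≠ k → (x.1 : Mat) i j = 0) ∧ (k ≠ 0 → x.2 = 0)}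
  zero_mem' := ⟨fun _ _ _ => rfl, fun _ => rfl⟩
  add_mem' := by
    rintro x y ⟨hx, hx'⟩ ⟨hy, hy'⟩
    exact ⟨fun i j h => by simp [hx i j h, hy i j h], fun h => by simp [hx' h, hy' h]⟩
  smul_mem' := by
    rintro c x ⟨hx, hx'⟩
    exact ⟨fun i j h => by simp [hx i j h], fun h => by simp [hx' h]⟩

/-- The coefficient functional `ω_s` on `D̂_0`, for a positive (doubled) half integer `s`:
`ω_s (∑_{r > 0} a_r ẽ_{rr} + d C) = a_s`, where `ẽ_{rr} = e_{rr} - e_{-r,-r}`. -/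
noncomputable def omega (s : ℤ) : Module.Dual ℂ (HatD.deg 0) where
  toFun x := (x.1.1 : Mat) s s
  map_add' _ _ := rfl
  map_smul' _ _ := rfl

/-- The functional `Λ_0` on `D̂_0`: `Λ_0 (∑_{r > 0} a_r ẽ_{rr} + d C) = d`. -/
noncomputable def Lambda0 : Module.Dual ℂ (HatD.deg 0) where
  toFun x := x.1.2
  map_add' _ _ := rfl
  map_smul' _ _ := rfl

/-- A `D̂`-module structure on the complex vector space `M`: a `ℤ/2`-grading of `M` and a linear
action of `D̂` which respects the parities and turns brackets into super commutators. -/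
structure HatDModule (M : Type*) [AddCommGroup M] [Module ℂ M] where
  act : HatD →ₗ[ℂ] M →ₗ[ℂ] M
  parity : ZMod 2 → Submodule ℂ M
  isInternal : DirectSum.IsInternal parity
  act_parity : ∀ (k : ℤ), ∀ x ∈ HatD.deg k, ∀ (ε : ZMod 2), ∀ m ∈ parity ε,
    act x m ∈ parity ((k : ZMod 2) + ε)
  act_bracket : ∀ (k l : ℤ), ∀ x ∈ HatD.deg k, ∀ y ∈ HatD.deg l, ∀ m : M,
    act (HatD.bracket x y) m = act x (act y m) - (-1 : ℂ) ^ (k * l) • act y (act x m)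

namespace HatDModule

variable {M : Type*} [AddCommGroup M] [Module ℂ M]

/-- There are no `ℤ/2`-graded submodules besides `0 ≠ M` and `M`. -/
def IsIrreducible (ρ : HatDModule M) : Prop :=
  Nontrivial M ∧ ∀ W : Submodule ℂ M, (∀ x : HatD, ∀ m ∈ W, ρ.act x m ∈ W) →
    W ≤ ⨆ ε, W ⊓ ρ.parity ε → W = ⊥ ∨ W = ⊤

/-- `M` is a highest weight module with highest weight `ξ` and highest weight vector `v`. The
operators on `M` given by the enveloping algebra of `D̂_- = ⨁_{k < 0} D̂_k` are the subalgebra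
generated by the action of `D̂_-`. -/
structure IsHighestWeight (ρ : HatDModule M) (ξ : Module.Dual ℂ (HatD.deg 0)) (v : M) : Prop where
  ne_zero : v ≠ 0
  weight : ∀ h : HatD.deg 0, ρ.act h v = ξ h • v
  annihilated : ∀ k : ℤ, 0 < k → ∀ x ∈ HatD.deg k, ρ.act x v = 0
  generates : ∀ m : M, ∃ a ∈ Algebra.adjoin ℂ
    {T : Module.End ℂ M | ∃ x ∈ ⨆ k < (0 : ℤ), HatD.deg k, T = ρ.act x}, a v = m

/-- The component of (doubled) degree `k` of the module generated by `v`, where `v` is declared to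
have degree `0`: the span of the vectors `x_1 ⋯ x_n v` with `x_i` homogeneous of total degree
`k`. -/
def component (ρ : HatDModule M) (v : M) (k : ℤ) : Submodule ℂ M :=
  Submodule.span ℂ {m | ∃ l : List (ℤ × HatD), (∀ p ∈ l, p.2 ∈ HatD.deg p.1) ∧
    (l.map Prod.fst).sum = k ∧ m = l.foldr (fun p u => ρ.act p.2 u) v}

/-- All homogeneous components, for the grading in which the highest weight vector `v` has degree
`0`, are finite dimensional. -/
def IsQuasiFinite (ρ : HatDModule M) (v : M) : Prop :=
  ∀ k : ℤ, FiniteDimensional ℂ (ρ.component v k)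

/-- The subspace `D̂_k v`. -/
noncomputable def degApply (ρ : HatDModule M) (k : ℤ) (v : M) : Submodule ℂ M :=
  (HatD.deg k).map (ρ.act.flip v)

end HatDModule

end InfRank

/-!
All degrees are doubled, as in the definitions.

The grading element `E = ∑_{r > 0} 2 r ẽ_{rr}` lies in `D̂_0`, and `ad E` is minus the degree. Hence
`𝒰(D̂_-) v` splits into eigenspaces of `E`, one for each degree, whatever the weight `ξ` is. In an
irreducible highest weight module a singular vector of negative degree therefore vanishes: the graded
submodule it generates lies in negative degrees and misses `v`
(`HatDModule.eq_zero_of_mem_singularVectors`).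

Suppose `ξ` is a finite combination of the `ω_s` and `Λ_0`. Then `ξ` vanishes on the elements of
`D̂_0` that are far from the origin, that is, whose rows and columns near the origin are zero.
Bracketing moves supports by a bounded amount, and the cocycle does not see matrices far from the
origin. So, by induction on the degree, an element of `D̂_{-n}` far from the origin sends `v` to a
singular vector, hence to zero (`HatDModule.IsHighestWeight.act_eq_zero_of_mem_Far`). Commuting
further, each vector `y_1 ⋯ y_n v` is killed by all elements of a given degree far enough from the
origin (`HatDModule.IsDescendant.exists_Far`). Since these have finite codimension, all components
are finite dimensional (`HatDModule.finiteDimensional_descendants`).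

Conversely, suppose `D̂_{-1} v` is finite dimensional. The matrices of degree `-1` have arbitrary
sequences of coefficients, so some nonzero polynomial `p` gives, through its values, an element `f_p`
of `D̂_{-1}` with `f_p v = 0`. For every `g` of degree `1` this gives `ξ ([g, f_p]) = 0`. As `p` has
finitely many zeros, the brackets `[g, f_p]` exhaust the elements of `D̂_0` far from the origin, so
`ξ` vanishes on them (`HatDModule.IsHighestWeight.exists_weight_eq_zero`) and has the required form
(`eq_sum_omega_add_Lambda0`).
-/

namespace InfRank

/-! ### Brackets and the cocycle in homogeneous degrees -/

lemma superBracket_of_diagonal {P : Mat} (hP : ∀ i j, i ≠ j → P i j = 0) (A : Mat) (i j : ℤ) :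
    superBracket P A i j = (P i i - P j j) * A i j := by
  rw [superBracket, mul, finsum_eq_single _ i fun k hk => by simp [hP i k hk.symm],
    finsum_eq_single _ j fun k hk => by simp [hP k j hk]]
  simp
  ring

lemma superBracket_of_homogeneous {A B : Mat} {k l : ℤ} (hA : ∀ i j : ℤ, j - i ≠ k → A i j = 0)
    (hB : ∀ i j : ℤ, j - i ≠ l → B i j = 0) (i j : ℤ) :
    superBracket A B i j = A i (i + k) * B (i + k) j
      - (-1 : ℂ) ^ (l * (j - (i + l))) * (B i (i + l) * A (i + l) j) := by
  rw [superBracket, mul, finsum_eq_single _ (i + k) fun m hm => by simp [hA i m (by omega)],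
    finsum_eq_single _ (i + l) fun m hm => by simp [hB i m (by omega)], add_sub_cancel_left]

/-- The cocycle only sees the entries that cross the boundary between `r ≤ 0` and `0 < r`. -/
lemma cocycle_eq_zero {A B : Mat}
    (h : ∀ i j : ℤ, A i j ≠ 0 → B j i ≠ 0 → (i ≤ 0 ↔ j ≤ 0)) : cocycle A B = 0 := by
  refine finsum_eq_zero_of_forall_eq_zero fun i => ?_
  rw [mul, finsum_eq_zero_of_forall_eq_zero, mul_zero]
  intro j
  rw [superBracket_of_diagonal fun i j hij => by simp [J, hij]]
  by_cases hA : A i j = 0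
  · simp [hA]
  by_cases hB : B j i = 0
  · simp [hB]
  simp [J, h i j hA hB]

lemma HatD.bracket_mem_deg {k l : ℤ} {x y : HatD} (hx : x ∈ HatD.deg k) (hy : y ∈ HatD.deg l) :
    HatD.bracket x y ∈ HatD.deg (k + l) := by
  refine ⟨fun i j hij => ?_, fun hkl => cocycle_eq_zero fun i j hA hB => ?_⟩
  · have h1 := hy.1 (i + k) j (by omega)
    have h2 := hx.1 (i + l) j (by omega)
    simp [HatD.bracket, superBracket_of_homogeneous hx.1 hy.1, h1, h2]
  · have h1 := not_imp_comm.mp (hx.1 i j) hA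
    have h2 := not_imp_comm.mp (hy.1 j i) hB
    omega

/-- Every element of `D̂` is a finite sum of homogeneous ones, because matrices are banded. -/
lemma HatD.iSup_deg : ⨆ k, HatD.deg k = ⊤ := by
  rw [eq_top_iff]
  rintro ⟨A, c⟩ -
  obtain ⟨K, hK⟩ := A.2.1
  let comp (k : ℤ) : D := ⟨fun i j => if j - i = k then (A : Mat) i j else 0,
    ⟨K, fun i j h => by simp [hK i j h]⟩, fun i j h => by simp [A.2.2.1 i j h],
    preservesForm_of_flip (fun i j h => by simp [A.2.2.1 i j h]) fun i j _ hj => by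
      have : -i - -j = j - i := by ring
      rw [this]
      split_ifs
      · exact D_flip A.2 i hj
      · simp⟩
  have hdec : ((A, c) : HatD) = ∑ k ∈ Finset.Icc (-K) K, (comp k, (0 : ℂ)) + (0, c) := by
    refine Prod.ext (Subtype.ext ?_) (by simp [Prod.snd_sum])
    funext i j
    simp only [Prod.fst_add, Prod.fst_sum, add_zero, Submodule.coe_sum, Finset.sum_apply, comp]
    rw [Finset.sum_ite_eq]
    split_ifs with h
    · rfl
    · refine hK i j ?_
      by_contra h'
      exact h (by rw [Finset.mem_Icc]; exact abs_le.mp (not_lt.mp h'))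
  rw [hdec]
  refine add_mem (sum_mem fun k _ => Submodule.mem_iSup_of_mem k ⟨fun i j h => ?_, fun _ => rfl⟩)
    (Submodule.mem_iSup_of_mem 0 ⟨fun _ _ _ => rfl, fun h => absurd rfl h⟩)
  exact if_neg h

/-! ### Elements with prescribed entries in the positive quadrant -/

/-- The factor relating the `(i, j)` entry of a matrix in `𝒟` to the `(-j, -i)` entry. -/
noncomputable def flipFactor (i j : ℤ) : ℂ :=
  -((-1 : ℂ) ^ ((j - i) * j) * (form i (-i) * form j (-j)))

lemma flipFactor_mul_flipFactor {i j : ℤ} (hi : i ≠ 0) (hj : j ≠ 0) :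
    flipFactor i j * flipFactor (-j) (-i) = 1 := by
  have hform : ∀ n : ℤ, n ≠ 0 → form (-n) n = (-1) ^ n * form n (-n) := by
    intro n hn
    by_cases he : Even n <;> simp [form, he, hn, Int.sign_neg, neg_one_zpow_eq]
  have hpow : (-1 : ℂ) ^ ((j - i) * j) * (-1) ^ ((-i - -j) * -i) * ((-1) ^ i * (-1) ^ j) = 1 := by
    rw [← zpow_add₀ (by norm_num), ← zpow_add₀ (by norm_num), ← zpow_add₀ (by norm_num)]
    refine Even.neg_one_zpow ?_
    simp only [Int.even_add, Int.even_sub, Int.even_mul, even_neg]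
    tauto
  rw [flipFactor, flipFactor, neg_neg, neg_neg, hform i hi, hform j hj]
  have hi2 := form_sq hi
  have hj2 := form_sq hj
  generalize (-1 : ℂ) ^ ((j - i) * j) = s at *
  generalize (-1 : ℂ) ^ ((-i - -j) * -i) = t at *
  generalize form i (-i) = a at *
  generalize form j (-j) = b at *
  linear_combination a * a * b * b * hpow + b * b * hi2 + hj2

/-- The matrix of degree `d` in `𝒟` whose entry at a position `(i, i + d)` in the positive
quadrant is `c (min i (i + d))`; the negative quadrant is determined by the form, and the two
mixed quadrants are zero. -/
noncomputable def quadrant (d : ℤ) : (ℤ → ℂ) →ₗ[ℂ] D where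
  toFun c := ⟨fun i j => if j - i = d then
      if 0 < i ∧ 0 < j then c (min i j)
      else if i < 0 ∧ j < 0 then flipFactor (-j) (-i) * c (min (-i) (-j)) else 0
    else 0, by
    have h0 : ∀ i j : ℤ, i = 0 ∨ j = 0 → (if j - i = d then
        if 0 < i ∧ 0 < j then c (min i j)
        else if i < 0 ∧ j < 0 then flipFactor (-j) (-i) * c (min (-i) (-j)) else 0
      else 0) = 0 := by
      intro i j h
      rw [if_neg (by omega : ¬(0 < i ∧ 0 < j)), if_neg (by omega : ¬(i < 0 ∧ j < 0)), ite_self]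
    refine ⟨⟨|d|, fun i j h => if_neg ?_⟩, h0, preservesForm_of_flip h0 fun i j hi hj => ?_⟩
    · rintro rfl
      exact lt_irrefl _ h
    · rw [← neg_mul]
      change _ = flipFactor i j * _
      have hd : -i - -j = j - i := by ring
      simp only [hd, neg_neg]
      by_cases hij : j - i = d
      · simp only [if_pos hij]
        rcases lt_or_gt_of_ne hi with hi' | hi' <;> rcases lt_or_gt_of_ne hj with hj' | hj'
        · rw [if_pos (by omega), if_neg (by omega), if_pos (by omega), ← mul_assoc,
            flipFactor_mul_flipFactor hi hj, one_mul, min_comm]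
        · rw [if_neg (by omega), if_neg (by omega), if_neg (by omega), if_neg (by omega), mul_zero]
        · rw [if_neg (by omega), if_neg (by omega), if_neg (by omega), if_neg (by omega), mul_zero]
        · rw [if_neg (by omega), if_pos (by omega), if_pos (by omega), min_comm]
      · simp [hij]⟩
  map_add' c c' := by
    refine Subtype.ext (funext fun i => funext fun j => ?_)
    simp only [Submodule.coe_add, Pi.add_apply]
    split_ifs <;> ring
  map_smul' a c := by
    refine Subtype.ext (funext fun i => funext fun j => ?_)
    simp only [Submodule.coe_smul, Pi.smul_apply, smul_eq_mul, RingHom.id_apply]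
    split_ifs <;> ring

lemma quadrant_apply_of_pos {d : ℤ} (c : ℤ → ℂ) {i j : ℤ} (hd : j - i = d) (hi : 0 < i)
    (hj : 0 < j) : (quadrant d c : Mat) i j = c (min i j) := by
  simp [quadrant, hd, hi, hj]

lemma quadrant_mem_deg (d : ℤ) (c : ℤ → ℂ) : ((quadrant d c, 0) : HatD) ∈ HatD.deg d :=
  ⟨fun _ _ h => if_neg h, fun _ => rfl⟩

/-- Elements of `D̂_0` are determined by their positive diagonal and their central part. -/
lemma HatD.ext_deg_zero {x y : HatD} (hx : x ∈ HatD.deg 0) (hy : y ∈ HatD.deg 0)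
    (hdiag : ∀ s : ℤ, 0 < s → (x.1 : Mat) s s = (y.1 : Mat) s s) (hC : x.2 = y.2) : x = y := by
  refine Prod.ext (Subtype.ext (funext fun i => funext fun j => ?_)) hC
  by_cases hij : j - i = 0
  · obtain rfl : j = i := by omega
    rcases lt_trichotomy j 0 with hj | rfl | hj
    · have h1 := D_flip x.1.2 (-j) (j := -j) (by omega)
      have h2 := D_flip y.1.2 (-j) (j := -j) (by omega)
      rw [neg_neg] at h1 h2
      rw [h1, h2, hdiag (-j) (by omega)]
    · rw [x.1.2.2.1 0 0 (Or.inl rfl), y.1.2.2.1 0 0 (Or.inl rfl)]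
    · exact hdiag j hj
  · rw [hx.1 i j hij, hy.1 i j hij]

/-! ### The grading element -/

/-- The element `∑_{r > 0} 2 r ẽ_{rr}` of `D̂_0`, whose adjoint action is minus the (doubled)
degree. -/
noncomputable def gradingElement : HatD.deg 0 :=
  ⟨(quadrant 0 fun i => (i : ℂ), 0), quadrant_mem_deg 0 _⟩

lemma gradingElement_apply (i : ℤ) : (gradingElement.1.1 : Mat) i i = i := by
  rcases lt_trichotomy i 0 with hi | rfl | hi
  · have h := D_flip gradingElement.1.1.2 (-i) (j := -i) (by omega)
    have hp : (gradingElement.1.1 : Mat) (-i) (-i) = ((-i : ℤ) : ℂ) := by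
      rw [gradingElement, quadrant_apply_of_pos _ (by ring) (by omega) (by omega), min_self]
    have hsq := form_sq (j := -i) (by omega)
    rw [neg_neg] at h hsq
    rw [h, hsq, hp]
    simp
  · rw [gradingElement.1.1.2.2.1 0 0 (Or.inl rfl), Int.cast_zero]
  · rw [gradingElement, quadrant_apply_of_pos _ (by ring) hi hi, min_self]

lemma bracket_gradingElement {k : ℤ} {x : HatD} (hx : x ∈ HatD.deg k) :
    HatD.bracket gradingElement x = (-k : ℂ) • x := by
  have hdiag : ∀ i j : ℤ, i ≠ j → (gradingElement.1.1 : Mat) i j = 0 := fun i j hij =>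
    gradingElement.2.1 i j (by omega)
  refine Prod.ext (Subtype.ext (funext fun i => funext fun j => ?_)) ?_
  · change superBracket _ _ i j = -(k : ℂ) * (x.1 : Mat) i j
    rw [superBracket_of_diagonal hdiag, gradingElement_apply, gradingElement_apply]
    by_cases hij : j - i = k
    · rw [← hij]
      push_cast
      ring
    · rw [hx.1 i j hij, mul_zero, mul_zero]
  · have h0 : HatD.bracket gradingElement x ∈ HatD.deg (0 + k) :=
      HatD.bracket_mem_deg gradingElement.2 hx
    change cocycle _ _ = -(k : ℂ) * x.2
    by_cases hk : k = 0
    · subst hk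
      rw [cocycle_eq_zero]
      · simp
      · intro i j hA _
        rw [not_imp_comm.mp (hdiag i j) hA]
    · rw [hx.2 hk, mul_zero]
      exact h0.2 (by omega)

/-! ### Matrices far from the origin -/

/-- The elements of `𝒟` whose rows and columns with index at most `N` in absolute value
vanish. -/
noncomputable def Far (N : ℤ) : Submodule ℂ HatD where
  carrier := {x | (∀ i j : ℤ, |i| ≤ N ∨ |j| ≤ N → (x.1 : Mat) i j = 0) ∧ x.2 = 0}
  zero_mem' := ⟨fun _ _ _ => rfl, rfl⟩
  add_mem' := by
    rintro x y ⟨hx, hx'⟩ ⟨hy, hy'⟩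
    exact ⟨fun i j h => by simp [hx i j h, hy i j h], by simp [hx', hy']⟩
  smul_mem' := by
    rintro c x ⟨hx, hx'⟩
    exact ⟨fun i j h => by simp [hx i j h], by simp [hx']⟩

lemma Far_anti {N N' : ℤ} (h : N ≤ N') : Far N' ≤ Far N := fun _ hx =>
  ⟨fun i j hij => hx.1 i j (hij.imp (le_trans · h) (le_trans · h)), hx.2⟩

/-- Bracketing with an element of degree `l` moves the support of a matrix by at most `|l|`; the
bound `|k| ≤ N` keeps the support away from the boundary seen by the cocycle. -/
lemma bracket_mem_Far {k l N : ℤ} {x y : HatD} (hx : x ∈ HatD.deg k) (hxN : x ∈ Far N)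
    (hkN : |k| ≤ N) (hy : y ∈ HatD.deg l) : HatD.bracket x y ∈ Far (N - |l|) := by
  refine ⟨fun i j hij => ?_, cocycle_eq_zero fun i j hA _ => ?_⟩
  · simp only [HatD.bracket]
    rw [superBracket_of_homogeneous hx.1 hy.1]
    have habs : ∀ m : ℤ, |m| ≤ N - |l| → |m| ≤ N ∧ |m + l| ≤ N ∧ |m - l| ≤ N := by
      intro m hm
      simp only [abs_le] at hm ⊢
      have := neg_abs_le l
      have := le_abs_self l
      omega
    rcases hij with hi | hj
    · have h := habs i hi
      simp [hxN.1 i (i + k) (Or.inl h.1), hxN.1 (i + l) j (Or.inl h.2.1)]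
    · have h := habs j hj
      rw [hxN.1 (i + l) j (Or.inr h.1)]
      by_cases hj' : j - (i + k) = l
      · rw [hxN.1 i (i + k) (Or.inr (by rw [show i + k = j - l by omega]; exact h.2.2))]
        simp
      · rw [hy.1 (i + k) j hj']
        simp
  · have h1 := not_imp_comm.mp (hx.1 i j) hA
    have h2 := mt (hxN.1 i j) hA
    have h3 := abs_le.mp hkN
    rw [not_or, abs_le, abs_le] at h2
    omega

lemma finiteDimensional_map_of_ker_le {V W M : Type*} [AddCommGroup V] [Module ℂ V]
    [AddCommGroup W] [Module ℂ W] [FiniteDimensional ℂ W] [AddCommGroup M] [Module ℂ M]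
    (P : Submodule ℂ V) (g : V →ₗ[ℂ] W) (f : V →ₗ[ℂ] M) (h : ∀ x ∈ P, g x = 0 → f x = 0) :
    FiniteDimensional ℂ (P.map f) := by
  have hker : LinearMap.ker (g.domRestrict P) ≤ LinearMap.ker (f.domRestrict P) :=
    fun x hx => h x x.2 hx
  have : FiniteDimensional ℂ (P ⧸ LinearMap.ker (g.domRestrict P)) :=
    Module.Finite.equiv (g.domRestrict P).quotKerEquivRange.symm
  rw [← LinearMap.range_domRestrict, ← Submodule.range_liftQ _ _ hker]
  infer_instance

/-- The elements of `D̂_k` far from the origin have finite codimension: a linear map which kills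
them has finite dimensional image on `D̂_k`. -/
lemma finiteDimensional_map_deg {M : Type*} [AddCommGroup M] [Module ℂ M] {k N : ℤ} (hk : k ≠ 0)
    (f : HatD →ₗ[ℂ] M) (hf : ∀ x ∈ HatD.deg k, x ∈ Far N → f x = 0) :
    FiniteDimensional ℂ ((HatD.deg k).map f) := by
  let window : Finset ℤ := Finset.Icc (-(N + |k|)) (N + |k|)
  let entries : HatD →ₗ[ℂ] (window → ℂ) :=
    { toFun := fun x i => (x.1 : Mat) i (i + k)
      map_add' := fun _ _ => rfl
      map_smul' := fun _ _ => rfl }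
  refine finiteDimensional_map_of_ker_le _ entries f fun x hx h0 =>
    hf x hx ⟨fun i j hij => ?_, hx.2 hk⟩
  by_cases hd : j - i = k
  · have hi : i ∈ window := by
      rw [Finset.mem_Icc]
      have := neg_abs_le k
      have := le_abs_self k
      rw [abs_le, abs_le] at hij
      omega
    obtain rfl : j = i + k := by omega
    exact congrFun h0 ⟨i, hi⟩
  · exact hx.1 i j hd

namespace HatDModule

variable {M : Type*} [AddCommGroup M] [Module ℂ M] {ρ : HatDModule M}

/-! ### Submodules generated by singular vectors -/

lemma act_act {k l : ℤ} {x y : HatD} (hx : x ∈ HatD.deg k) (hy : y ∈ HatD.deg l) (m : M) :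
    ρ.act x (ρ.act y m) =
      ρ.act (HatD.bracket x y) m + (-1 : ℂ) ^ (k * l) • ρ.act y (ρ.act x m) := by
  rw [ρ.act_bracket k l x hx y hy, sub_add_cancel]

/-- `IsDescendant ρ S k m` says that `m = y_1 ⋯ y_n s` with `s ∈ S` and with homogeneous `y_i` of
negative degree, of total degree `k`. -/
inductive IsDescendant (ρ : HatDModule M) (S : Submodule ℂ M) : ℤ → M → Prop
  | base {s : M} (hs : s ∈ S) : IsDescendant ρ S 0 s
  | step {l k : ℤ} {y : HatD} {m : M} (hl : l < 0) (hy : y ∈ HatD.deg l)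
      (hm : IsDescendant ρ S k m) : IsDescendant ρ S (l + k) (ρ.act y m)

/-- The part of degree `k` of `𝒰(D̂_-) S`, where `S` is placed in degree `0`. -/
def descendants (ρ : HatDModule M) (S : Submodule ℂ M) (k : ℤ) : Submodule ℂ M :=
  Submodule.span ℂ {m | IsDescendant ρ S k m}

/-- The subspace `S` is stable under `D̂_0` and killed by `D̂_k` for `k > 0`. -/
structure IsSingular (ρ : HatDModule M) (S : Submodule ℂ M) : Prop where
  stable : ∀ x ∈ HatD.deg 0, ∀ s ∈ S, ρ.act x s ∈ S
  annihilated : ∀ k : ℤ, 0 < k → ∀ x ∈ HatD.deg k, ∀ s ∈ S, ρ.act x s = 0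

lemma IsDescendant.mem {S : Submodule ℂ M} {k : ℤ} {m : M} (h : IsDescendant ρ S k m) :
    m ∈ ρ.descendants S k :=
  Submodule.subset_span h

lemma IsDescendant.nonpos {S : Submodule ℂ M} {k : ℤ} {m : M} (h : IsDescendant ρ S k m) :
    k ≤ 0 := by
  induction h with
  | base hs => exact le_rfl
  | step hl hy hm ih => omega

lemma act_mem_descendants_of_neg {S : Submodule ℂ M} {l k : ℤ} (hl : l < 0) {x : HatD}
    (hx : x ∈ HatD.deg l) {m : M} (hm : m ∈ ρ.descendants S k) :
    ρ.act x m ∈ ρ.descendants S (l + k) := by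
  have : ρ.descendants S k ≤ (ρ.descendants S (l + k)).comap (ρ.act x) :=
    Submodule.span_le.mpr fun m hm => (IsDescendant.step hl hx hm).mem
  exact this hm

/-- For singular `S`, the space `𝒰(D̂_-) S` is a `D̂`-submodule, because elements of nonnegative
degree can be commuted to the right. -/
lemma IsSingular.act_mem_descendants {S : Submodule ℂ M} (hS : IsSingular ρ S) {l k : ℤ} {x : HatD}
    (hx : x ∈ HatD.deg l) {m : M} (hm : m ∈ ρ.descendants S k) :
    ρ.act x m ∈ ρ.descendants S (l + k) := by
  suffices h : ∀ m, IsDescendant ρ S k m → ∀ l, ∀ x ∈ HatD.deg l,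
      ρ.act x m ∈ ρ.descendants S (l + k) by
    have : ρ.descendants S k ≤ (ρ.descendants S (l + k)).comap (ρ.act x) :=
      Submodule.span_le.mpr fun m hm => h m hm l x hx
    exact this hm
  clear hx hm
  intro m hm
  induction hm with
  | base hs =>
    intro l x hx
    rcases lt_trichotomy l 0 with hl | rfl | hl
    · exact (IsDescendant.step hl hx (.base hs)).mem
    · exact (IsDescendant.base (hS.stable x hx _ hs)).mem
    · rw [hS.annihilated l hl x hx _ hs]
      exact zero_mem _
  | @step l' k y m hl' hy hm ih =>
    intro l x hx
    rw [act_act hx hy]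
    refine add_mem ?_ (Submodule.smul_mem _ _ ?_)
    · rw [← add_assoc]
      exact ih _ _ (HatD.bracket_mem_deg hx hy)
    · rw [add_left_comm]
      exact act_mem_descendants_of_neg hl' hy (ih l x hx)

lemma gradingElement_act {k : ℤ} {x : HatD} (hx : x ∈ HatD.deg k) {m : M} {μ : ℂ}
    (hm : ρ.act gradingElement m = μ • m) :
    ρ.act gradingElement (ρ.act x m) = (μ - k) • ρ.act x m := by
  rw [act_act gradingElement.2 hx, bracket_gradingElement hx, hm]
  simp only [map_smul, LinearMap.smul_apply, zero_mul, zpow_zero, one_smul]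
  rw [← add_smul]
  congr 1
  ring

/-- The grading element separates the degrees. -/
lemma descendants_le_eigenspace {S : Submodule ℂ M} {μ : ℂ}
    (hS : S ≤ Module.End.eigenspace (ρ.act gradingElement) μ) (k : ℤ) :
    ρ.descendants S k ≤ Module.End.eigenspace (ρ.act gradingElement) (μ - k) := by
  refine Submodule.span_le.mpr fun m hm => ?_
  rw [Set.mem_ofPred_eq] at hm
  rw [SetLike.mem_coe, Module.End.mem_eigenspace_iff]
  induction hm with
  | base hs =>
    rw [Int.cast_zero, sub_zero]
    exact Module.End.mem_eigenspace_iff.mp (hS hs)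
  | step hl hy hm ih =>
    rw [gradingElement_act hy ih]
    congr 1
    push_cast
    ring

lemma iSup_descendants_stable {S : Submodule ℂ M} (hS : IsSingular ρ S) (x : HatD) {m : M}
    (hm : m ∈ ⨆ k, ρ.descendants S k) : ρ.act x m ∈ ⨆ k, ρ.descendants S k := by
  have hle : (⨆ k, HatD.deg k) ≤ (⨆ k, ρ.descendants S k).comap (ρ.act.flip m) := by
    refine iSup_le fun l y hy => ?_
    have : (⨆ k, ρ.descendants S k) ≤ (⨆ k, ρ.descendants S k).comap (ρ.act y) :=
      iSup_le fun k m hm => Submodule.mem_iSup_of_mem (l + k) (hS.act_mem_descendants hy hm)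
    exact this hm
  rw [HatD.iSup_deg] at hle
  exact hle (Submodule.mem_top (x := x))

/-! ### Parity -/

lemma exists_parity_add (m : M) :
    ∃ a ∈ ρ.parity 0, ∃ b ∈ ρ.parity 1, a + b = m := by
  have h := ρ.isInternal.isCompl (i := 0) (j := 1) (by decide)
    (Set.eq_univ_of_forall (by decide : ∀ ε : ZMod 2, ε = 0 ∨ ε = 1)).symm
  exact Submodule.mem_sup.mp (h.sup_eq_top ▸ Submodule.mem_top)

lemma eq_zero_of_parity_add {ε ε' : ZMod 2} (hε : ε ≠ ε') {a b : M} (ha : a ∈ ρ.parity ε)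
    (hb : b ∈ ρ.parity ε') (hab : a + b = 0) : a = 0 ∧ b = 0 := by
  have h := ρ.isInternal.submodule_iSupIndep.pairwiseDisjoint hε
  have ha0 : a = 0 := Submodule.disjoint_def.mp h a ha (by
    rw [eq_neg_of_add_eq_zero_left hab]
    exact neg_mem hb)
  exact ⟨ha0, by rwa [ha0, zero_add] at hab⟩

lemma iSup_descendants_graded {S : Submodule ℂ M} (hS : S ≤ ⨆ ε, S ⊓ ρ.parity ε) :
    (⨆ k, ρ.descendants S k) ≤ ⨆ ε, (⨆ k, ρ.descendants S k) ⊓ ρ.parity ε := by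
  refine iSup_le fun k => Submodule.span_le.mpr fun m hm => ?_
  rw [Set.mem_ofPred_eq] at hm
  rw [SetLike.mem_coe]
  induction hm with
  | base hs =>
    have hle : S ≤ ⨆ k, ρ.descendants S k := fun s hs =>
      Submodule.mem_iSup_of_mem 0 (IsDescendant.base hs).mem
    exact iSup_mono (fun ε => inf_le_inf_right _ hle) (hS hs)
  | @step l k y m hl hy hm ih =>
    have hle : (⨆ ε, (⨆ k, ρ.descendants S k) ⊓ ρ.parity ε) ≤
        (⨆ ε, (⨆ k, ρ.descendants S k) ⊓ ρ.parity ε).comap (ρ.act y) := by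
      refine iSup_le fun ε m hm => Submodule.mem_iSup_of_mem ((l : ZMod 2) + ε)
        ⟨?_, ρ.act_parity l y hy ε m hm.2⟩
      have : (⨆ k, ρ.descendants S k) ≤ (⨆ k, ρ.descendants S k).comap (ρ.act y) :=
        iSup_le fun k m hm =>
          Submodule.mem_iSup_of_mem (l + k) (act_mem_descendants_of_neg hl hy hm)
      exact this hm.1
    exact hle ih

/-- The space of singular vectors of eigenvalue `μ` under the grading element. -/
def singularVectors (ρ : HatDModule M) (μ : ℂ) : Submodule ℂ M where
  carrier := {m | ρ.act gradingElement m = μ • m ∧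
    ∀ k : ℤ, 0 < k → ∀ x ∈ HatD.deg k, ρ.act x m = 0}
  zero_mem' := ⟨by simp, fun _ _ _ _ => map_zero _⟩
  add_mem' := by
    rintro a b ⟨ha, ha'⟩ ⟨hb, hb'⟩
    exact ⟨by rw [map_add, ha, hb, smul_add],
      fun k hk x hx => by rw [map_add, ha' k hk x hx, hb' k hk x hx, add_zero]⟩
  smul_mem' := by
    rintro c a ⟨ha, ha'⟩
    exact ⟨by rw [map_smul, ha, smul_comm],
      fun k hk x hx => by rw [map_smul, ha' k hk x hx, smul_zero]⟩

lemma isSingular_singularVectors (μ : ℂ) : IsSingular ρ (ρ.singularVectors μ) := by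
  refine ⟨fun x hx s hs => ⟨?_, fun k hk y hy => ?_⟩, fun k hk x hx s hs => hs.2 k hk x hx⟩
  · rw [gradingElement_act hx hs.1, Int.cast_zero, sub_zero]
  · rw [act_act hy hx, hs.2 k hk y hy, map_zero, smul_zero, add_zero]
    exact hs.2 (k + 0) (by omega) _ (HatD.bracket_mem_deg hy hx)

lemma singularVectors_graded (μ : ℂ) :
    ρ.singularVectors μ ≤ ⨆ ε, ρ.singularVectors μ ⊓ ρ.parity ε := by
  rintro s hs
  obtain ⟨a, ha, b, hb, rfl⟩ := ρ.exists_parity_add s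
  have hE : ∀ ε : ZMod 2, ∀ m ∈ ρ.parity ε,
      ρ.act gradingElement m - μ • m ∈ ρ.parity ε := by
    intro ε m hm
    have h := ρ.act_parity 0 _ gradingElement.2 ε m hm
    rw [Int.cast_zero, zero_add] at h
    exact sub_mem h (Submodule.smul_mem _ _ hm)
  have h1 := eq_zero_of_parity_add (by decide) (hE 0 a ha) (hE 1 b hb) (by
    have h := sub_eq_zero.mpr hs.1
    rw [map_add, smul_add] at h
    rw [← h]
    abel)
  have h2 : ∀ k : ℤ, 0 < k → ∀ x ∈ HatD.deg k, ρ.act x a = 0 ∧ ρ.act x b = 0 :=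
    fun k hk x hx => eq_zero_of_parity_add (by simp) (ρ.act_parity k x hx 0 a ha)
      (ρ.act_parity k x hx 1 b hb) (by rw [← map_add]; exact hs.2 k hk x hx)
  exact add_mem
    (Submodule.mem_iSup_of_mem 0
      ⟨⟨sub_eq_zero.mp h1.1, fun k hk x hx => (h2 k hk x hx).1⟩, ha⟩)
    (Submodule.mem_iSup_of_mem 1
      ⟨⟨sub_eq_zero.mp h1.2, fun k hk x hx => (h2 k hk x hx).2⟩, hb⟩)

/-! ### Irreducible highest weight modules -/

/-- A singular vector of negative degree `-n` vanishes in an irreducible highest weight module: the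
graded submodule it generates lies in degrees at most `-n`, so does not contain `v`. -/
lemma eq_zero_of_mem_singularVectors {ξ : Module.Dual ℂ (HatD.deg 0)} {v : M}
    (hirr : ρ.IsIrreducible) (hv : ρ.IsHighestWeight ξ v) {n : ℤ} (hn : 0 < n) {m : M}
    (hm : m ∈ ρ.singularVectors (ξ gradingElement + n)) : m = 0 := by
  set S := ρ.singularVectors (ξ gradingElement + n) with hSdef
  have hmW : m ∈ ⨆ k, ρ.descendants S k :=
    Submodule.mem_iSup_of_mem 0 (IsDescendant.base hm).mem
  rcases hirr.2 (⨆ k, ρ.descendants S k)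
    (fun x m hm => iSup_descendants_stable (isSingular_singularVectors _) x hm)
    (iSup_descendants_graded (singularVectors_graded _)) with h | h
  · rwa [h, Submodule.mem_bot] at hmW
  · have hvE : v ∈ Module.End.eigenspace (ρ.act gradingElement) (ξ gradingElement) :=
      Module.End.mem_eigenspace_iff.mpr (hv.weight gradingElement)
    have hSE : S ≤ Module.End.eigenspace (ρ.act gradingElement) (ξ gradingElement + n) :=
      fun s (hs : s ∈ ρ.singularVectors _) => Module.End.mem_eigenspace_iff.mpr hs.1
    have hle : (⨆ k, ρ.descendants S k) ≤ ⨆ (μ : ℂ) (_ : μ ≠ ξ gradingElement),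
        Module.End.eigenspace (ρ.act gradingElement) μ := by
      refine iSup_le fun k => ?_
      rcases le_or_gt k 0 with hk | hk
      · refine (descendants_le_eigenspace hSE k).trans (le_iSup₂_of_le _ ?_ le_rfl)
        intro h
        have h' : ((n - k : ℤ) : ℂ) = 0 := by
          push_cast
          linear_combination h
        rw [Int.cast_eq_zero] at h'
        omega
      · refine Submodule.span_le.mpr fun m hm => ?_
        have := IsDescendant.nonpos hm
        omega
    have hind := Module.End.eigenspaces_iSupIndep (ρ.act gradingElement) (ξ gradingElement)
    exact absurd (Submodule.disjoint_def.mp hind v hvE (hle (h ▸ Submodule.mem_top))) hv.ne_zero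

lemma IsHighestWeight.isSingular {ξ : Module.Dual ℂ (HatD.deg 0)} {v : M}
    (hv : ρ.IsHighestWeight ξ v) : IsSingular ρ (ℂ ∙ v) := by
  refine ⟨fun x hx s hs => ?_, fun k hk x hx s hs => ?_⟩ <;>
    obtain ⟨c, rfl⟩ := Submodule.mem_span_singleton.mp hs
  · rw [map_smul, hv.weight ⟨x, hx⟩, smul_smul]
    exact Submodule.smul_mem _ _ (Submodule.mem_span_singleton_self v)
  · rw [map_smul, hv.annihilated k hk x hx, smul_zero]

lemma IsHighestWeight.component_le {ξ : Module.Dual ℂ (HatD.deg 0)} {v : M}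
    (hv : ρ.IsHighestWeight ξ v) (k : ℤ) : ρ.component v k ≤ ρ.descendants (ℂ ∙ v) k := by
  refine Submodule.span_le.mpr ?_
  rintro _ ⟨l, hl, rfl, rfl⟩
  induction l with
  | nil => exact (IsDescendant.base (Submodule.mem_span_singleton_self v)).mem
  | cons p l ih =>
    rw [List.map_cons, List.sum_cons, List.foldr_cons]
    exact hv.isSingular.act_mem_descendants (hl p List.mem_cons_self)
      (ih fun q hq => hl q (List.mem_cons_of_mem _ hq))

/-- If `ξ` vanishes far from the origin, then so does every element of `D̂_{-n}` far from the
origin on the highest weight vector `v`: by induction on `n` its value on `v` is singular. -/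
lemma IsHighestWeight.act_eq_zero_of_mem_Far {ξ : Module.Dual ℂ (HatD.deg 0)} {v : M}
    (hirr : ρ.IsIrreducible) (hv : ρ.IsHighestWeight ξ v) {N : ℤ} (hN : 0 ≤ N)
    (hξ : ∀ h : HatD.deg 0, (h : HatD) ∈ Far N → ξ h = 0) (n : ℕ) {x : HatD}
    (hx : x ∈ HatD.deg (-n)) (hxN : x ∈ Far (N + n)) : ρ.act x v = 0 := by
  induction n using Nat.strong_induction_on generalizing x with
  | _ n ih =>
  rcases Nat.eq_zero_or_pos n with rfl | hn
  · rw [Nat.cast_zero, neg_zero] at hx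
    rw [Nat.cast_zero, add_zero] at hxN
    rw [hv.weight ⟨x, hx⟩, hξ ⟨x, hx⟩ hxN, zero_smul]
  refine eq_zero_of_mem_singularVectors hirr hv (n := n) (by omega) ⟨?_, fun l hl y hy => ?_⟩
  · rw [gradingElement_act hx (hv.weight _)]
    congr 1
    push_cast
    ring
  · have hb : ρ.act (HatD.bracket x y) v = 0 := by
      have hdeg := HatD.bracket_mem_deg hx hy
      have hfar := bracket_mem_Far hx hxN (by rw [abs_neg, Nat.abs_cast]; omega) hy
      rcases le_or_gt l n with hln | hln
      · lift l to ℕ using hl.le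
        refine ih (n - l) (by omega) (x := HatD.bracket x y) ?_ ?_
        · rwa [show -((n - l : ℕ) : ℤ) = -n + l by omega]
        · rwa [Nat.abs_cast, show N + n - (l : ℤ) = N + (n - l : ℕ) by omega] at hfar
      · exact hv.annihilated _ (by omega) _ hdeg
    rw [ρ.act_bracket _ _ x hx y hy, hv.annihilated l hl y hy, map_zero, zero_sub,
      neg_eq_zero, smul_eq_zero] at hb
    exact hb.resolve_left (zpow_ne_zero _ (by norm_num))

/-- If `ξ` vanishes far from the origin, every descendant of `v` is killed by the elements of a
given degree which are far enough from the origin: commuting past the factors of the descendant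
moves supports by a bounded amount only. -/
lemma IsDescendant.exists_Far {ξ : Module.Dual ℂ (HatD.deg 0)} {v : M}
    (hirr : ρ.IsIrreducible) (hv : ρ.IsHighestWeight ξ v) {N : ℤ} (hN : 0 ≤ N)
    (hξ : ∀ h : HatD.deg 0, (h : HatD) ∈ Far N → ξ h = 0) {k : ℤ} {m : M}
    (hm : IsDescendant ρ (ℂ ∙ v) k m) (d : ℤ) :
    ∃ L : ℤ, ∀ x ∈ HatD.deg d, x ∈ Far L → ρ.act x m = 0 := by
  induction hm generalizing d with
  | base hs =>
    obtain ⟨c, rfl⟩ := Submodule.mem_span_singleton.mp hs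
    rcases lt_or_ge 0 d with hd | hd
    · exact ⟨0, fun x hx _ => by rw [map_smul, hv.annihilated d hd x hx, smul_zero]⟩
    · obtain ⟨n, rfl⟩ : ∃ n : ℕ, d = -n := ⟨d.natAbs, by omega⟩
      exact ⟨N + n, fun x hx hxN => by
        rw [map_smul, hv.act_eq_zero_of_mem_Far hirr hN hξ n hx hxN, smul_zero]⟩
  | @step l k y m hl hy hm ih =>
    obtain ⟨L₁, h₁⟩ := ih d
    obtain ⟨L₂, h₂⟩ := ih (d + l)
    refine ⟨max (max L₁ (L₂ + |l|)) |d|, fun x hx hxN => ?_⟩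
    rw [act_act hx hy, h₁ x hx (Far_anti (by omega) hxN), map_zero, smul_zero, add_zero]
    exact h₂ _ (HatD.bracket_mem_deg hx hy)
      (Far_anti (by omega) (bracket_mem_Far hx hxN (by omega) hy))

lemma finiteDimensional_descendants {ξ : Module.Dual ℂ (HatD.deg 0)} {v : M}
    (hirr : ρ.IsIrreducible) (hv : ρ.IsHighestWeight ξ v) {N : ℤ} (hN : 0 ≤ N)
    (hξ : ∀ h : HatD.deg 0, (h : HatD) ∈ Far N → ξ h = 0) (n : ℕ) :
    FiniteDimensional ℂ (ρ.descendants (ℂ ∙ v) (-n)) := by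
  induction n using Nat.strong_induction_on with
  | _ n ih =>
  have hstep : ∀ l : Fin n, ∃ K : Submodule ℂ M, FiniteDimensional ℂ K ∧
      ∀ y ∈ HatD.deg (-((l : ℕ) + 1 : ℕ)), ∀ m ∈ ρ.descendants (ℂ ∙ v) (-((n - (l + 1) : ℕ) : ℤ)),
        ρ.act y m ∈ K := by
    intro l
    have hfg := (Submodule.fg_iff_finiteDimensional _).mpr (ih (n - (l + 1)) (by omega))
    obtain ⟨t, ht, hspan⟩ := (Submodule.fg_span_iff_fg_span_finset_subset _).mp hfg
    refine ⟨⨆ m : t, (HatD.deg (-((l : ℕ) + 1 : ℕ))).map (ρ.act.flip m), ?_, fun y hy m hm => ?_⟩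
    · have : ∀ m : t, FiniteDimensional ℂ
          ((HatD.deg (-((l : ℕ) + 1 : ℕ))).map (ρ.act.flip m)) := by
        intro m
        obtain ⟨L, hL⟩ := IsDescendant.exists_Far hirr hv hN hξ (ht m.2) (-((l : ℕ) + 1 : ℕ))
        exact finiteDimensional_map_deg (by omega) _ hL
      infer_instance
    · have hle : Submodule.span ℂ (t : Set M) ≤
          (⨆ m : t, (HatD.deg (-((l : ℕ) + 1 : ℕ))).map (ρ.act.flip m)).comap (ρ.act y) :=
        Submodule.span_le.mpr fun m hm =>
          Submodule.mem_iSup_of_mem ⟨m, hm⟩ (Submodule.mem_map_of_mem hy)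
      exact hle (hspan ▸ hm)
  choose K hK hmem using hstep
  have hle : ρ.descendants (ℂ ∙ v) (-n) ≤ (ℂ ∙ v) ⊔ ⨆ l, K l := by
    refine Submodule.span_le.mpr fun m hm => ?_
    generalize hk : -(n : ℤ) = k at hm
    rw [Set.mem_ofPred_eq] at hm
    cases hm with
    | base hs => exact Submodule.mem_sup_left hs
    | @step l k y m hl hy hm =>
      have hk0 := hm.nonpos
      refine Submodule.mem_sup_right (Submodule.mem_iSup_of_mem ⟨(-l - 1).toNat, by omega⟩
        (hmem _ y ?_ m ?_))
      · convert hy using 2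
        simp only
        omega
      · convert hm.mem using 2
        simp only
        omega
  exact Submodule.finiteDimensional_of_le hle

/-! ### Finite dimensionality in degree `-1` -/

lemma cocycle_quadrant_one (b c : ℤ → ℂ) : cocycle (quadrant 1 b) (quadrant (-1) c) = 0 := by
  refine cocycle_eq_zero fun i j hA _ => ?_
  have h0 := (quadrant 1 b).2.2.1 i j
  have h1 := not_imp_comm.mp ((quadrant_mem_deg 1 b).1 i j) hA
  have hi : i ≠ 0 := fun h => hA (h0 (Or.inl h))
  omega

/-- The bracket of elements of degrees `1` and `-1` in terms of the pointwise product of their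
coefficient sequences. -/
lemma superBracket_quadrant_one (b c : ℤ → ℂ) {s : ℤ} (hs : 0 < s) :
    superBracket (quadrant 1 b) (quadrant (-1) c) s s =
      b s * c s + if s = 1 then 0 else b (s - 1) * c (s - 1) := by
  rw [superBracket_of_homogeneous (quadrant_mem_deg 1 b).1 (quadrant_mem_deg (-1) c).1,
    quadrant_apply_of_pos b (by ring) hs (by omega),
    quadrant_apply_of_pos c (by ring) (by omega) hs, min_eq_left (by omega),
    min_eq_right (by omega), show -1 * (s - (s + -1)) = -1 by ring]
  split_ifs with h
  · subst h
    rw [(quadrant (-1) c).2.2.1 1 (1 + -1) (Or.inr rfl)]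
    simp
  · rw [quadrant_apply_of_pos c (by ring) hs (by omega),
      quadrant_apply_of_pos b (by ring) (by omega) hs, min_eq_right (by omega),
      min_eq_left (by omega), ← sub_eq_add_neg]
    norm_num
    ring

/-- If `D̂_{-1} v` is finite dimensional, some nonzero polynomial, used as a sequence of
coefficients, gives an element of `D̂_{-1}` killing `v`. It has finitely many zeros, so its
brackets with `D̂_1` contain everything in `D̂_0` far from the origin. -/
lemma IsHighestWeight.exists_weight_eq_zero {ξ : Module.Dual ℂ (HatD.deg 0)} {v : M}
    (hv : ρ.IsHighestWeight ξ v) (hfin : FiniteDimensional ℂ (ρ.degApply (-1) v)) :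
    ∃ N : ℕ, ∀ h : HatD.deg 0, h.1.2 = 0 → (∀ s : ℤ, 0 < s → s ≤ N → (h.1.1 : Mat) s s = 0) →
      ξ h = 0 := by
  let evalSeq : Polynomial ℂ →ₗ[ℂ] (ℤ → ℂ) :=
    LinearMap.pi fun j : ℤ => Polynomial.leval (j : ℂ)
  let lower : (ℤ → ℂ) →ₗ[ℂ] ρ.degApply (-1) v :=
    LinearMap.codRestrict _ (ρ.act.flip v ∘ₗ LinearMap.inl ℂ D ℂ ∘ₗ quadrant (-1)) fun c =>
      Submodule.mem_map_of_mem (quadrant_mem_deg (-1) c)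
  obtain ⟨p, hp0, hp⟩ : ∃ p : Polynomial ℂ, p ≠ 0 ∧ lower (evalSeq p) = 0 := by
    by_contra! hcon
    have hinj : Function.Injective (lower ∘ₗ evalSeq) :=
      (injective_iff_map_eq_zero _).mpr fun p hp => by_contra fun h => hcon p h hp
    have := Module.Finite.of_injective _ hinj
    exact Polynomial.not_finite this
  have hpv : ρ.act (quadrant (-1) (evalSeq p), 0) v = 0 := congrArg Subtype.val hp
  obtain ⟨N, hN⟩ : ∃ N : ℕ, ∀ j : ℤ, (N : ℤ) < j → p.eval (j : ℂ) ≠ 0 := by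
    have hroots : {j : ℤ | p.eval (j : ℂ) = 0}.Finite :=
      (Polynomial.finite_setOfPred_isRoot hp0).preimage Int.cast_injective.injOn
    obtain ⟨B, hB⟩ := hroots.bddAbove
    exact ⟨B.toNat, fun j hj h0 => by have := hB h0; omega⟩
  refine ⟨N, fun h hC hdiag => ?_⟩
  -- the sequence with `c s + c (s - 1) = h s s`
  let c : ℕ → ℂ := fun n => Nat.rec 0 (fun n cn => (h.1.1 : Mat) (n + 1 : ℕ) (n + 1 : ℕ) - cn) n
  have hc : ∀ n, c (n + 1) = (h.1.1 : Mat) (n + 1 : ℕ) (n + 1 : ℕ) - c n := fun n => rfl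
  have hc0 : ∀ n ≤ N, c n = 0 := by
    intro n hn
    induction n with
    | zero => rfl
    | succ n ih => rw [hc, ih (by omega), hdiag _ (by omega) (by omega), sub_zero]
  let b : ℤ → ℂ := fun j => c j.toNat / p.eval (j : ℂ)
  have hbc : ∀ j : ℤ, b j * evalSeq p j = c j.toNat := by
    intro j
    change c j.toNat / p.eval (j : ℂ) * p.eval (j : ℂ) = _
    rcases le_or_gt j N with hj | hj
    · rw [hc0 _ (by omega), zero_div, zero_mul]
    · exact div_mul_cancel₀ _ (hN j hj)
  have hbr : HatD.bracket (quadrant 1 b, 0) (quadrant (-1) (evalSeq p), 0) = h := by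
    have hdeg := HatD.bracket_mem_deg (quadrant_mem_deg 1 b) (quadrant_mem_deg (-1) (evalSeq p))
    rw [show (1 : ℤ) + -1 = 0 by norm_num] at hdeg
    refine HatD.ext_deg_zero hdeg h.2 ?_ ?_
    · intro s hs
      change superBracket _ _ s s = _
      rw [superBracket_quadrant_one _ _ hs, hbc, hbc]
      obtain ⟨n, rfl⟩ : ∃ n : ℕ, s = (n + 1 : ℕ) := ⟨(s - 1).toNat, by omega⟩
      rw [Int.toNat_natCast, hc, show (((n + 1 : ℕ) : ℤ) - 1).toNat = n by omega]
      split_ifs with h1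
      · obtain rfl : n = 0 := by omega
        simp [hc0]
      · ring
    · exact (cocycle_quadrant_one _ _).trans hC.symm
  have hact : ρ.act h v = 0 := by
    rw [← hbr, ρ.act_bracket 1 (-1) _ (quadrant_mem_deg 1 b) _ (quadrant_mem_deg (-1) _), hpv,
      hv.annihilated 1 one_pos _ (quadrant_mem_deg 1 b), map_zero, map_zero, smul_zero, sub_zero]
  rw [hv.weight] at hact
  exact (smul_eq_zero.mp hact).resolve_right hv.ne_zero

end HatDModule

/-- A functional on `D̂_0` which vanishes far from the origin is a finite combination of the `ω_s`
and `Λ_0`. -/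
lemma eq_sum_omega_add_Lambda0 {ξ : Module.Dual ℂ (HatD.deg 0)} {N : ℕ}
    (hξ : ∀ h : HatD.deg 0, h.1.2 = 0 → (∀ s : ℤ, 0 < s → s ≤ N → (h.1.1 : Mat) s s = 0) →
      ξ h = 0) :
    ∃ (c : ℤ → ℂ) (d : ℂ),
      ξ = (∑ j ∈ Finset.Icc (1 : ℤ) N, c j • omega j) + d • Lambda0 := by
  let e (j : ℤ) : HatD.deg 0 := ⟨(quadrant 0 (Pi.single j 1), 0), quadrant_mem_deg 0 _⟩
  let C : HatD.deg 0 := ⟨(0, 1), fun _ _ _ => rfl, fun h => absurd rfl h⟩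
  refine ⟨fun j => ξ (e j), ξ C, LinearMap.ext fun h => ?_⟩
  have hΛ : ∀ x : HatD.deg 0, x.1.2 = Lambda0 x := fun _ => rfl
  have hω : ∀ (s : ℤ) (x : HatD.deg 0), (x.1.1 : Mat) s s = omega s x := fun _ _ => rfl
  have hrest : ξ (h + (-1 : ℂ) • (∑ j ∈ Finset.Icc (1 : ℤ) N, omega j h • e j + Lambda0 h • C))
      = 0 := by
    refine hξ _ ?_ fun s hs hsN => ?_
    · rw [hΛ]
      have he : ∀ j, Lambda0 (e j) = 0 := fun _ => rfl
      have hC : Lambda0 C = 1 := rfl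
      simp only [map_add, map_sum, map_smul, he, hC, smul_eq_mul, mul_zero,
        Finset.sum_const_zero]
      ring
    · rw [hω]
      have he : ∀ j, omega s (e j) = if s = j then 1 else 0 := fun j => by
        change (quadrant 0 (Pi.single j 1) : Mat) s s = _
        rw [quadrant_apply_of_pos _ (by ring) hs hs, min_self, Pi.single_apply]
      have hC : omega s C = 0 := rfl
      have hmem : s ∈ Finset.Icc (1 : ℤ) N := Finset.mem_Icc.mpr ⟨hs, hsN⟩
      simp only [map_add, map_sum, map_smul, he, hC, smul_eq_mul, mul_ite, mul_one,
        mul_zero, add_zero, Finset.sum_ite_eq, if_pos hmem]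
      ring
  simp only [map_add, map_sum, map_smul, smul_eq_mul] at hrest
  simp only [LinearMap.add_apply, LinearMap.sum_apply, LinearMap.smul_apply, smul_eq_mul,
    mul_comm (ξ _)]
  linear_combination hrest

end InfRank

theorem mainTheorem9 {M : Type*} [AddCommGroup M] [Module ℂ M] (ρ : InfRank.HatDModule M)
    (hirr : ρ.IsIrreducible) (ξ : Module.Dual ℂ (InfRank.HatD.deg 0)) (v : M)
    (hv : ρ.IsHighestWeight ξ v) :
    List.TFAE [
      ρ.IsQuasiFinite v,
      FiniteDimensional ℂ (ρ.degApply (-1) v),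
      ∃ (N : ℕ) (c : ℤ → ℂ) (d : ℂ),
        ξ = (∑ j ∈ Finset.Icc (1 : ℤ) (2 * N), c j • InfRank.omega j) + d • InfRank.Lambda0] := by
  tfae_have 1 → 2 := by
    intro h
    have := h (-1)
    refine Submodule.finiteDimensional_of_le (S₂ := ρ.component v (-1)) ?_
    rintro _ ⟨x, hx, rfl⟩
    exact Submodule.subset_span ⟨[(-1, x)], by simpa using hx, by simp, rfl⟩
  tfae_have 2 → 3 := by
    intro h
    obtain ⟨N, hN⟩ := hv.exists_weight_eq_zero h
    obtain ⟨c, d, h⟩ := InfRank.eq_sum_omega_add_Lambda0 (N := 2 * N) fun h hC hdiag =>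
      hN h hC fun s hs hsN => hdiag s hs (by omega)
    exact ⟨N, c, d, by simpa using h⟩
  tfae_have 3 → 1 := by
    rintro ⟨N, c, d, rfl⟩ k
    have hfar : ∀ h : InfRank.HatD.deg 0, (h : InfRank.HatD) ∈ InfRank.Far (2 * N) →
        ((∑ j ∈ Finset.Icc (1 : ℤ) (2 * N), c j • InfRank.omega j) + d • InfRank.Lambda0) h
          = 0 := by
      intro h hh
      have hω : ∀ j ∈ Finset.Icc (1 : ℤ) (2 * N), c j * InfRank.omega j h = 0 := by
        intro j hj
        rw [Finset.mem_Icc] at hj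
        have : InfRank.omega j h = 0 := hh.1 j j (Or.inl (by rw [abs_le]; omega))
        rw [this, mul_zero]
      have hΛ : InfRank.Lambda0 h = 0 := hh.2
      simp [Finset.sum_eq_zero hω, hΛ]
    rcases le_or_gt k 0 with hk | hk
    · obtain ⟨n, rfl⟩ : ∃ n : ℕ, k = -n := ⟨k.natAbs, by omega⟩
      have := InfRank.HatDModule.finiteDimensional_descendants hirr hv (by omega) hfar n
      exact Submodule.finiteDimensional_of_le (hv.component_le _)
    · refine Submodule.finiteDimensional_of_le (S₂ := ⊥) ((hv.component_le k).trans
        (Submodule.span_le.mpr fun m hm => ?_))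
      have := InfRank.HatDModule.IsDescendant.nonpos hm
      omega
  tfae_finish
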